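/- Consider wild card indexing over the binary alphabet. An input of size $n$ is a finite set $\mathcal D\subset\{0,1\}^*$ of documents of total length $n$; a query is a pattern $P\in\{0,1,*\}^m$, of any length $m$, with exactly $\kappa$ wild cards $*$, and it must report the set of all $d\in\mathcal D$ in which $P$ occurs, i.e. that have a contiguous block of length $m$ agreeing with $P$ at every non-wild-card position. A pointer-machine structure for $\mathcal D$ is a finite directed graph of out-degree at most two with a root, each of whose vertices (memory cells) stores at most one element of $\mathcal D$; its space is its number of cells. A query is answered by exploring a set $W$ of cells that contains the root, in which every cell is reached from the root by following pointers inside $W$, and such that every document to be reported is stored in some cell of $W$; its query time is $|W|$. (All other computation is free.) There is an absolute constant $c>0$ with the following property. Let $\kappa=\kappa(n)$ be integers with $3\sqrt{\log_2 n}\le\kappa$ for all large $n$ and $\kappa=o(\log n)$. Let $Q(n,\kappa)=O(2^{\kappa/2})$ and let $\alpha$ be a constant. Suppose that, for all large $n$, every input of size $n$ has a pointer-machine structure with at most $S(n,\kappa)$ cells that answers every pattern with $\kappa$ wild cards in time at most $Q(n,\kappa)+\alpha(m+t)$, where $m$ is the pattern length and $t$ the number of reported documents. Then, for all sufficiently large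 $n$, $$S(n,\kappa)\ \ge\ n^{\,1+c/\log_2\kappa},$$ that is, $S(n,\kappa)\ge n^{1+\Theta(1/\log\kappa)}$. -/

import Mathlib

open Filter Asymptotics

/-- A pointer-machine data structure (for one fixed input) for a reporting problem over the
universe `U` of input elements: a directed graph of out-degree at most two on `size` memory cells,
with a root, in which every cell stores at most one element of `U`. -/
structure PointerStructure (U : Type) where
  /-- the number of memory cells, i.e. the space used -/
  size : ℕ
  /-- the cell at which every query starts -/
  root : Fin size
  /-- the two pointers of a cell (`none` is a null pointer) -/
  ptr : Fin size → Fin 2 → Option (Fin size)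
  /-- the input element stored in a cell, if any -/
  stored : Fin size → Option U

namespace PointerStructure

variable {U : Type}

/-- `W` is a set of cells that a query can explore: it contains the root, and every cell of `W` is
reached from the root by following pointers between cells of `W`. -/
def Explorable (G : PointerStructure U) (W : Finset (Fin G.size)) : Prop :=
  G.root ∈ W ∧
    ∀ v ∈ W, Relation.ReflTransGen
      (fun a b => a ∈ W ∧ b ∈ W ∧ ∃ i : Fin 2, G.ptr a i = some b) G.root v

/-- By exploring the cells in `W`, a query finds every element of its output `out`. -/
def Reports (G : PointerStructure U) (W : Finset (Fin G.size)) (out : Finset U) : Prop :=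
  G.Explorable W ∧ ∀ u ∈ out, ∃ v ∈ W, G.stored v = some u

end PointerStructure

/-- A pattern over the binary alphabet with wild cards; `none` is the wild card. -/
abbrev WildPattern : Type := List (Option Bool)

/-- The pattern `P` occurs in the document `d`: some contiguous block of `d` has the length of `P`
and agrees with `P` at every position of `P` that is not a wild card. -/
def WildPattern.OccursIn (P : WildPattern) (d : List Bool) : Prop :=
  ∃ w : List Bool, w <:+: d ∧ List.Forall₂ (fun p c => ∀ b : Bool, p = some b → c = b) P w

open Classical in
/-- The set of documents that are matched by the pattern `P`. -/
noncomputable def wildOutput (docs : Finset (List Bool)) (P : WildPattern) :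
    Finset {d : List Bool // d ∈ docs} :=
  Finset.univ.filter (fun d => P.OccursIn d.1)

/-- Wild card indexing with `κ` wild cards can be solved on inputs of size `n` with at most `s`
memory cells and query time `q + α (m + t)`: for every set of binary documents of total length `n`
there is a pointer-machine structure with at most `s` cells that reports, for every pattern with
`κ` wild cards, all matched documents, exploring at most `q + α (m + t)` cells, where `m` is the
length of the pattern and `t` is the number of matched documents. -/
def WCISolvable (n κ : ℕ) (q α s : ℝ) : Prop :=
  ∀ docs : Finset (List Bool), (∑ d ∈ docs, d.length) = n →
    ∃ G : PointerStructure {d : List Bool // d ∈ docs},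
      (G.size : ℝ) ≤ s ∧
      ∀ P : WildPattern, P.count none = κ →
        ∃ W : Finset (Fin G.size),
          G.Reports W (wildOutput docs P) ∧
          (W.card : ℝ) ≤ q + α * ((P.length : ℝ) + ((wildOutput docs P).card : ℝ))

/-! Suppose any two queries share at most one output and each explores fewer than `(t - 1) * (l +
1)` cells for its `t` outputs. Then each query has two outputs stored within `l` pointers of a
common cell. That cell and the two paths determine the two outputs, hence the query, so there are at
most `size * 9 ^ l` queries (`card_queries_le`).

For the hard input, split `k * q` positions into `k = κ` blocks of length `q`. A function `f : Fin k
→ Fin q` chooses one position per block. The query of `f` has its wild cards there and zeros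
elsewhere; the documents are indicator words of restrictions of `f` to sets `X` in a constant weight
code `A`, with `|X| = a = k / 2`. Two shared outputs make two functions agree on a union `X ∪ Y`, of
size at least `a + g` with `g = k / 64`, so it suffices that distinct functions in the family `F`
never agree on that many blocks.

There are at most `|A| * q ^ a` documents but at least `q ^ (a + g) / 2 ^ k` queries. With `q` as
large as the input size permits, the ratio `(a + g) / (a + 1)` exceeds 1 by a constant, and factors
`2 ^ O(k)` are `n ^ o(1)` since `κ = o(log n)`. This gives exponent `1 + 1 / 300`, stronger than
required. -/

namespace PointerStructure

variable {U : Type}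

/-! ### Counting queries on a pointer machine -/

/-- Follow a pointer; `none` and null pointers stay in place. -/
def move (G : PointerStructure U) (v : Fin G.size) : Option (Fin 2) → Fin G.size
  | none => v
  | some i => (G.ptr v i).getD v

/-- Follow a sequence of pointers. -/
def follow (G : PointerStructure U) (v : Fin G.size) (p : List (Option (Fin 2))) : Fin G.size :=
  p.foldl G.move v

/-- The cells of `W ∪ {v}` from which `v` is reached by at most `k` pointers inside `W`. -/
def reachers (G : PointerStructure U) (W : Finset (Fin G.size)) (v : Fin G.size) :
    ℕ → Finset (Fin G.size)
  | 0 => {v}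
  | k + 1 => reachers G W v k ∪ {w ∈ W | ∃ i : Fin 2, ∃ b ∈ reachers G W v k, G.ptr w i = some b}

theorem reachers_subset (G : PointerStructure U) {W : Finset (Fin G.size)} {v : Fin G.size}
    (hv : v ∈ W) (k : ℕ) : G.reachers W v k ⊆ W := by
  induction k with
  | zero => simpa [reachers] using hv
  | succ k ih => exact Finset.union_subset ih (Finset.filter_subset _ _)

theorem mem_reachers_self (G : PointerStructure U) (W : Finset (Fin G.size)) (v : Fin G.size)
    (k : ℕ) : v ∈ G.reachers W v k := by
  induction k with
  | zero => simp [reachers]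
  | succ k ih => exact Finset.mem_union_left _ ih

theorem exists_follow_of_mem_reachers (G : PointerStructure U) {W : Finset (Fin G.size)}
    {v w : Fin G.size} {k : ℕ} (hw : w ∈ G.reachers W v k) :
    ∃ p : List.Vector (Option (Fin 2)) k, G.follow w p.toList = v := by
  induction k generalizing w with
  | zero =>
    refine ⟨List.Vector.nil, ?_⟩
    simpa [reachers, follow] using hw
  | succ k ih =>
    rcases Finset.mem_union.1 hw with h | h
    · obtain ⟨p, hp⟩ := ih h
      exact ⟨p.cons none, by simpa [follow, move] using hp⟩
    · obtain ⟨-, i, b, hb, hi⟩ := Finset.mem_filter.1 h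
      obtain ⟨p, hp⟩ := ih hb
      exact ⟨p.cons (some i), by simpa [follow, move, hi] using hp⟩

/-- A backward ball gains a cell at each step until it stabilises; once stable it is closed under
predecessors in `W`, so the path from the root to `v` pulls the root into it. -/
theorem root_mem_or_card_reachers (G : PointerStructure U) {W : Finset (Fin G.size)}
    (hW : G.Explorable W) {v : Fin G.size} (hv : v ∈ W) (k : ℕ) :
    G.root ∈ G.reachers W v k ∨ k + 1 ≤ (G.reachers W v k).card := by
  induction k with
  | zero => right; simp [reachers]
  | succ k ih =>
    rcases ih with h | h
    · exact Or.inl (Finset.mem_union_left _ h)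
    · by_cases heq : G.reachers W v (k + 1) = G.reachers W v k
      · left
        refine Relation.ReflTransGen.head_induction_on
          (motive := fun x _ => x ∈ G.reachers W v (k + 1)) (hW.2 v hv)
          (G.mem_reachers_self W v _) ?_
        rintro x y ⟨hx, -, i, hi⟩ - hy
        rw [heq] at hy
        exact Finset.mem_union_right _ (Finset.mem_filter.2 ⟨hx, i, y, hy, hi⟩)
      · right
        have hlt : (G.reachers W v k).card < (G.reachers W v (k + 1)).card :=
          Finset.card_lt_card ((Finset.subset_union_left).ssubset_of_ne (Ne.symm heq))
        omega

/-- If few cells are explored per marked cell, then two marked cells have a close common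
ancestor. -/
theorem exists_close_pair (G : PointerStructure U) {W M : Finset (Fin G.size)}
    (hW : G.Explorable W) (hM : M ⊆ W) (l : ℕ) (hc : W.card < (M.card - 1) * (l + 1)) :
    ∃ u ∈ M, ∃ v ∈ M, u ≠ v ∧ ∃ w, w ∈ G.reachers W u l ∧ w ∈ G.reachers W v l := by
  by_contra! hne
  have hdisj : ∀ u ∈ M, ∀ v ∈ M, u ≠ v → Disjoint (G.reachers W u l) (G.reachers W v l) :=
    fun u hu v hv huv => Finset.disjoint_left.2 (hne u hu v hv huv)
  -- Two balls containing the root would meet there. This one exceptional ball accounts for the `-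
  -- 1` in `hc`.
  have hroot : (M.filter fun v => G.root ∈ G.reachers W v l).card ≤ 1 := by
    refine Finset.card_le_one.2 fun u hu v hv => ?_
    rw [Finset.mem_filter] at hu hv
    by_contra huv
    exact hne u hu.1 v hv.1 huv _ hu.2 hv.2
  have hsplit := Finset.card_filter_add_card_filter_not (s := M)
    (fun v => G.root ∈ G.reachers W v l)
  set N := M.filter fun v => ¬ G.root ∈ G.reachers W v l with hN
  have hNM : ∀ v ∈ N, v ∈ M := fun v hv => (Finset.mem_filter.1 hv).1
  have hle : N.card * (l + 1) ≤ W.card := by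
    calc N.card * (l + 1) = ∑ _v ∈ N, (l + 1) := by simp
      _ ≤ ∑ v ∈ N, (G.reachers W v l).card := Finset.sum_le_sum fun v hv =>
          (G.root_mem_or_card_reachers hW (hM (hNM v hv)) l).resolve_left
            (Finset.mem_filter.1 hv).2
      _ = (N.biUnion fun v => G.reachers W v l).card :=
          (Finset.card_biUnion fun u hu v hv huv => hdisj u (hNM u hu) v (hNM v hv) huv).symm
      _ ≤ W.card := Finset.card_le_card <| Finset.biUnion_subset.2 fun v hv =>
          G.reachers_subset (hM (hNM v hv)) l
  have : (M.card - 1) * (l + 1) ≤ N.card * (l + 1) := Nat.mul_le_mul_right _ (by omega)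
  omega

theorem exists_close_outputs (G : PointerStructure U) {W : Finset (Fin G.size)} {out : Finset U}
    (hR : G.Reports W out) (l : ℕ) (hc : W.card < (out.card - 1) * (l + 1)) :
    ∃ (w : Fin G.size) (p p' : List.Vector (Option (Fin 2)) l), ∃ x ∈ out, ∃ y ∈ out, x ≠ y ∧
      G.stored (G.follow w p.toList) = some x ∧ G.stored (G.follow w p'.toList) = some y := by
  classical
  obtain ⟨hW, hout⟩ := hR
  have : Nonempty (Fin G.size) := ⟨G.root⟩
  choose! c hcW hc' using hout
  have hinj : Set.InjOn c out := fun x hx y hy hxy => by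
    have := hc' x hx
    rw [hxy, hc' y hy] at this
    exact (Option.some.inj this).symm
  obtain ⟨u, hu, v, hv, huv, w, hwu, hwv⟩ := G.exists_close_pair (M := out.image c) hW
    (Finset.image_subset_iff.2 hcW) l (by rwa [Finset.card_image_of_injOn hinj])
  obtain ⟨x, hx, rfl⟩ := Finset.mem_image.1 hu
  obtain ⟨y, hy, rfl⟩ := Finset.mem_image.1 hv
  obtain ⟨p, hp⟩ := G.exists_follow_of_mem_reachers hwu
  obtain ⟨p', hp'⟩ := G.exists_follow_of_mem_reachers hwv
  exact ⟨w, p, p', x, hx, y, hy, fun h => huv (by rw [h]), by rw [hp, hc' x hx],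
    by rw [hp', hc' y hy]⟩

/-- A pointer machine lower bound for families of queries any two of which have at most one
output in common. -/
theorem card_queries_le (G : PointerStructure U) {ι : Type*} (F : Finset ι) (out : ι → Finset U)
    (hout : ∀ f ∈ F, ∀ f' ∈ F, ∀ x ∈ out f, ∀ y ∈ out f, x ≠ y → x ∈ out f' → y ∈ out f' → f = f')
    (l : ℕ) (hF : ∀ f ∈ F, ∃ W, G.Reports W (out f) ∧ W.card < ((out f).card - 1) * (l + 1)) :
    F.card ≤ G.size * 9 ^ l := by
  classical
  have key : ∀ f ∈ F, ∃ z : Fin G.size × List.Vector (Option (Fin 2)) l ×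
      List.Vector (Option (Fin 2)) l, ∃ x ∈ out f, ∃ y ∈ out f, x ≠ y ∧
      G.stored (G.follow z.1 z.2.1.toList) = some x ∧
      G.stored (G.follow z.1 z.2.2.toList) = some y := by
    intro f hf
    obtain ⟨W, hR, hc⟩ := hF f hf
    obtain ⟨w, p, p', h⟩ := G.exists_close_outputs hR l hc
    exact ⟨(w, p, p'), h⟩
  have : Nonempty (Fin G.size × List.Vector (Option (Fin 2)) l × List.Vector (Option (Fin 2)) l) :=
    ⟨(G.root, List.Vector.replicate l none, List.Vector.replicate l none)⟩
  choose! z hz using key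
  have hcard := Finset.card_le_card_of_injOn (s := F) (t := Finset.univ) z (by simp) (by
    intro f hf f' hf' hff
    obtain ⟨x, hx, y, hy, hxy, h1, h2⟩ := hz f hf
    obtain ⟨x', hx', y', hy', -, h1', h2'⟩ := hz f' hf'
    rw [← hff] at h1' h2'
    obtain rfl : x = x' := Option.some.inj (h1.symm.trans h1')
    obtain rfl : y = y' := Option.some.inj (h2.symm.trans h2')
    exact hout f hf f' hf' x hx y hy hxy hx' hy')
  -- Each path step has three options: either pointer, or staying put, which pads paths to length
  -- exactly `l`.
  have h9 : 3 ^ l * 3 ^ l = 9 ^ l := by rw [← mul_pow]; norm_num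
  simpa [card_vector, h9] using hcard

end PointerStructure

/-! ### Packing and codes -/

/-- Greedy packing: if every element is close to at most `b` elements, then there is a set of
pairwise non-close elements of proportion at least `1 / b`. -/
theorem exists_packing {X : Type*} (s : Finset X) (close : X → X → Prop)
    (hrefl : ∀ x ∈ s, close x x) (b : ℕ)
    (hb : ∀ x ∈ s, ∀ B ⊆ s, (∀ y ∈ B, close x y ∨ close y x) → B.card ≤ b) :
    ∃ F ⊆ s, (∀ x ∈ F, ∀ y ∈ F, x ≠ y → ¬ close x y) ∧ s.card ≤ F.card * b := by
  classical
  obtain ⟨p, hp⟩ : ∃ p : Finset X → Prop, ∀ F, p F ↔ ∀ x ∈ F, ∀ y ∈ F, x ≠ y → ¬ close x y :=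
    ⟨_, fun _ => Iff.rfl⟩
  obtain ⟨F, hF, hmax⟩ := Finset.exists_max_image (s.powerset.filter p) Finset.card
    ⟨∅, by simp [hp]⟩
  rw [Finset.mem_filter, Finset.mem_powerset, hp] at hF
  refine ⟨F, hF.1, hF.2, ?_⟩
  have hcover : s ⊆ F.biUnion fun x => s.filter fun y => close x y ∨ close y x := by
    intro y hy
    by_contra hn
    have hn' : ∀ x ∈ F, ¬ (close x y ∨ close y x) := fun x hx h =>
      hn (Finset.mem_biUnion.2 ⟨x, hx, Finset.mem_filter.2 ⟨hy, h⟩⟩)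
    have hyF : y ∉ F := fun h => hn' y h (Or.inl (hrefl y hy))
    have := hmax (insert y F) (by
      rw [Finset.mem_filter, Finset.mem_powerset, hp]
      refine ⟨Finset.insert_subset hy hF.1, ?_⟩
      intro u hu v hv huv
      rcases Finset.mem_insert.1 hu with rfl | hu'
      · rcases Finset.mem_insert.1 hv with rfl | hv'
        · exact absurd rfl huv
        · exact fun h => hn' v hv' (Or.inr h)
      · rcases Finset.mem_insert.1 hv with rfl | hv'
        · exact fun h => hn' u hu' (Or.inl h)
        · exact hF.2 u hu' v hv' huv)
    rw [Finset.card_insert_of_notMem hyF] at this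
    omega
  calc s.card ≤ _ := Finset.card_le_card hcover
    _ ≤ F.card * b := Finset.card_biUnion_le_card_mul _ _ _ fun x hx =>
        hb x (hF.1 hx) _ (Finset.filter_subset _ _) fun y hy => (Finset.mem_filter.1 hy).2

theorem card_functions_agreeing_on {k q : ℕ} (f : Fin k → Fin q) (E : Finset (Fin k)) :
    (Finset.univ.filter fun h : Fin k → Fin q => ∀ i ∈ E, f i = h i).card ≤ q ^ (k - E.card) := by
  classical
  have := Finset.card_le_card_of_injOn (s := Finset.univ.filter fun h : Fin k → Fin q =>
      ∀ i ∈ E, f i = h i) (t := (Finset.univ : Finset ({i // i ∉ E} → Fin q)))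
    (fun h i => h i.1) (by simp) (by
      intro h hh h' hh' heq
      simp only [Finset.coe_filter, Finset.mem_univ, true_and, Set.mem_ofPred_eq] at hh hh'
      funext i
      by_cases hi : i ∈ E
      · rw [← hh i hi, hh' i hi]
      · exact congrFun heq ⟨i, hi⟩)
  refine this.trans (le_of_eq ?_)
  simp [Fintype.card_subtype_compl]

/-- A Gilbert–Varshamov bound for codes whose words agree in few positions. -/
theorem exists_code (k q r : ℕ) (hr : r ≤ k) (hq : 0 < q) :
    ∃ F : Finset (Fin k → Fin q),
      (∀ f ∈ F, ∀ h ∈ F, ∀ E : Finset (Fin k), r ≤ E.card → (∀ i ∈ E, f i = h i) → f = h) ∧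
      q ^ r ≤ F.card * 2 ^ k := by
  classical
  obtain ⟨F, -, hF, hcard⟩ := exists_packing (Finset.univ : Finset (Fin k → Fin q))
    (fun f h => ∃ E : Finset (Fin k), r = E.card ∧ ∀ i ∈ E, f i = h i)
    (fun f _ => by
      obtain ⟨E, -, hE⟩ := Finset.exists_subset_card_eq (s := (Finset.univ : Finset (Fin k)))
        (n := r) (by simpa using hr)
      exact ⟨E, hE.symm, fun _ _ => rfl⟩)
    (2 ^ k * q ^ (k - r)) (by
      intro f _ B _ hB
      have hsub : B ⊆ (Finset.univ.filter fun E : Finset (Fin k) => r = E.card).biUnion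
          fun E => Finset.univ.filter fun h : Fin k → Fin q => ∀ i ∈ E, f i = h i := by
        intro h hh
        rw [Finset.mem_biUnion]
        rcases hB h hh with ⟨E, hE, hfh⟩ | ⟨E, hE, hfh⟩
        · exact ⟨E, by simpa using hE, by simpa using hfh⟩
        · exact ⟨E, by simpa using hE, by simpa using fun i hi => (hfh i hi).symm⟩
      refine (Finset.card_le_card hsub).trans ((Finset.card_biUnion_le_card_mul _ _
        (q ^ (k - r)) ?_).trans ?_)
      · intro E hE
        have hE' : r = E.card := by simpa using hE
        rw [hE']
        exact card_functions_agreeing_on f E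
      · refine Nat.mul_le_mul_right _ ((Finset.card_filter_le _ _).trans ?_)
        simp)
  refine ⟨F, ?_, ?_⟩
  · intro f hf h hh E hE hfh
    by_contra hne
    obtain ⟨E', hE', hcE⟩ := Finset.exists_subset_card_eq hE
    exact hF f hf h hh hne ⟨E', hcE.symm, fun i hi => hfh i (hE' hi)⟩
  · have hpos : 0 < q ^ (k - r) := by positivity
    refine Nat.le_of_mul_le_mul_right ?_ hpos
    have h1 : q ^ r * q ^ (k - r) = q ^ k := by rw [← pow_add]; congr 1; omega
    rw [h1]
    simpa [mul_assoc] using hcard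

/-- Weight `D` by `16 ^ (k - |D|)`: the total is `17 ^ k`, and each small set weighs at least `16 ^
k / 16 ^ d`. -/
theorem card_small_subsets (k d : ℕ) :
    (Finset.univ.filter fun D : Finset (Fin k) => D.card ≤ d).card * 16 ^ k ≤ 16 ^ d * 17 ^ k := by
  have h17 : ∑ D : Finset (Fin k), 16 ^ (k - D.card) = 17 ^ k := by
    have := Finset.sum_pow_mul_eq_add_pow (R := ℕ) 1 16 (Finset.univ : Finset (Fin k))
    simpa using this
  rw [← h17, Finset.card_eq_sum_ones, Finset.sum_mul, Finset.mul_sum]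
  refine (Finset.sum_le_sum fun D hD => ?_).trans
    (Finset.sum_le_sum_of_subset (Finset.filter_subset _ _))
  have hD' : D.card ≤ d := by simpa using hD
  have hk : D.card ≤ k := by simpa using Finset.card_le_univ D
  rw [one_mul, ← pow_add]
  exact Nat.pow_le_pow_right (by norm_num) (by omega)

/-- A Gilbert–Varshamov bound for constant weight codes. -/
theorem exists_constant_weight_code (k a g : ℕ) :
    ∃ A : Finset (Finset (Fin k)), (∀ X ∈ A, X.card = a) ∧
      (∀ X ∈ A, ∀ Y ∈ A, X ≠ Y → a + g ≤ (X ∪ Y).card) ∧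
      k.choose a ≤ A.card *
        (Finset.univ.filter fun D : Finset (Fin k) => D.card ≤ 2 * g).card := by
  classical
  -- For `g = 0` closeness is not reflexive, but all `a`-subsets will do.
  rcases Nat.eq_zero_or_pos g with rfl | hg
  · refine ⟨Finset.univ.powersetCard a, fun X hX => (Finset.mem_powersetCard.1 hX).2, ?_, ?_⟩
    · intro X hX Y _ _
      rw [← (Finset.mem_powersetCard.1 hX).2]
      exact Finset.card_le_card Finset.subset_union_left
    · have : 1 ≤ (Finset.univ.filter fun D : Finset (Fin k) => D.card ≤ 2 * 0).card :=
        Finset.card_pos.2 ⟨∅, by simp⟩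
      simpa using Nat.le_mul_of_pos_right (k.choose a) this
  obtain ⟨A, hA, hfar, hcard⟩ := exists_packing ((Finset.univ : Finset (Fin k)).powersetCard a)
    (fun X Y => (X ∪ Y).card < a + g)
    (fun X hX => by
      rw [Finset.union_self, (Finset.mem_powersetCard.1 hX).2]; omega)
    (Finset.univ.filter fun D : Finset (Fin k) => D.card ≤ 2 * g).card (by
      intro X hX B hB hclose
      have hX' := (Finset.mem_powersetCard.1 hX).2
      refine Finset.card_le_card_of_injOn (fun Y => symmDiff X Y) ?_ ?_
      · intro Y hY
        have hY' := (Finset.mem_powersetCard.1 (hB hY)).2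
        have hU : (X ∪ Y).card < a + g := by
          rcases hclose Y hY with h | h
          · exact h
          · rwa [Finset.union_comm]
        have h1 : (X \ Y).card + Y.card = (X ∪ Y).card := Finset.card_sdiff_add_card X Y
        have h2 : (Y \ X).card + X.card = (Y ∪ X).card := Finset.card_sdiff_add_card Y X
        rw [Finset.union_comm] at h2
        -- For sets of size `a`, each difference has `|X ∪ Y| - a < g` elements, so close sets lie
        -- in a Hamming ball of radius `2 * g`.
        have h3 : (symmDiff X Y).card ≤ (X \ Y).card + (Y \ X).card := Finset.card_union_le _ _
        simp only [Finset.coe_filter, Finset.mem_univ, true_and, Set.mem_ofPred_eq]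
        omega
      · exact (symmDiff_right_injective X).injOn)
  refine ⟨A, fun X hX => (Finset.mem_powersetCard.1 (hA hX)).2, fun X hX Y hY hne => ?_, ?_⟩
  · exact not_lt.1 (hfar X hX Y hY hne)
  · simpa using hcard

/-- Constant weight codes of linear distance and nearly full size. -/
theorem exists_large_constant_weight_code (k : ℕ) :
    ∃ A : Finset (Finset (Fin k)), (∀ X ∈ A, X.card = k / 2) ∧
      (∀ X ∈ A, ∀ Y ∈ A, X ≠ Y → k / 2 + k / 64 ≤ (X ∪ Y).card) ∧
      2 ^ (3 * k) ≤ (A.card * (k + 1)) ^ 4 := by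
  obtain ⟨A, h1, h2, h3⟩ := exists_constant_weight_code k (k / 2) (k / 64)
  refine ⟨A, h1, h2, ?_⟩
  set V := (Finset.univ.filter fun D : Finset (Fin k) => D.card ≤ 2 * (k / 64)).card with hV
  have hV1 : V * 16 ^ k ≤ 16 ^ (2 * (k / 64)) * 17 ^ k := card_small_subsets k _
  -- Base 16 works because `(17 / 16) ^ 8 ≤ 2`; the ball then has volume at most `2 ^ (k / 4)`.
  have h17 : (17 ^ 8) ^ k ≤ (2 * 16 ^ 8) ^ k := Nat.pow_le_pow_left (by norm_num) k
  have h16 : (16 ^ (2 * (k / 64))) ^ 8 ≤ 2 ^ k := by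
    rw [show (16 : ℕ) = 2 ^ 4 by norm_num, ← pow_mul, ← pow_mul]
    exact Nat.pow_le_pow_right (by norm_num) (by omega)
  have hV2 : V ^ 8 ≤ (2 ^ k) ^ 2 := by
    have hp : 0 < (16 ^ 8) ^ k := by positivity
    refine Nat.le_of_mul_le_mul_right ?_ hp
    calc V ^ 8 * (16 ^ 8) ^ k = (V * 16 ^ k) ^ 8 := by
          rw [mul_pow, ← pow_mul, ← pow_mul, mul_comm 8 k]
      _ ≤ (16 ^ (2 * (k / 64)) * 17 ^ k) ^ 8 := Nat.pow_le_pow_left hV1 8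
      _ = (16 ^ (2 * (k / 64))) ^ 8 * (17 ^ 8) ^ k := by
          rw [mul_pow, ← pow_mul 17 k 8, ← pow_mul 17 8 k, mul_comm 8 k]
      _ ≤ 2 ^ k * (2 * 16 ^ 8) ^ k := Nat.mul_le_mul h16 h17
      _ = (2 ^ k) ^ 2 * (16 ^ 8) ^ k := by rw [mul_pow]; ring
  have hV4 : V ^ 4 ≤ 2 ^ k := by
    refine le_of_pow_le_pow_left₀ (n := 2) (by norm_num) (by positivity) ?_
    simpa [← pow_mul] using hV2
  have hmid : 2 ^ k ≤ (k + 1) * k.choose (k / 2) := by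
    rw [← Nat.sum_range_choose k]
    refine (Finset.sum_le_sum fun i _ => Nat.choose_le_middle i k).trans ?_
    simp
  have h4 : 2 ^ k ≤ A.card * (k + 1) * V := by
    calc 2 ^ k ≤ (k + 1) * (A.card * V) := hmid.trans (Nat.mul_le_mul_left _ h3)
      _ = A.card * (k + 1) * V := by ring
  have hp : 0 < 2 ^ k := by positivity
  refine Nat.le_of_mul_le_mul_right ?_ hp
  calc 2 ^ (3 * k) * 2 ^ k = (2 ^ k) ^ 4 := by rw [← pow_mul, ← pow_add]; congr 1; ring
    _ ≤ (A.card * (k + 1) * V) ^ 4 := Nat.pow_le_pow_left h4 4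
    _ = (A.card * (k + 1)) ^ 4 * V ^ 4 := by rw [mul_pow]
    _ ≤ _ := Nat.mul_le_mul_left _ hV4

/-! ### Documents and patterns from functions -/

/-- The indicator word of the graph of the restriction of `f` to `X`. -/
def graphWord {k q : ℕ} (X : Finset (Fin k)) (f : Fin k → Fin q) : List Bool :=
  List.ofFn fun j : Fin (k * q) =>
    decide ((finProdFinEquiv.symm j).1 ∈ X ∧
      f (finProdFinEquiv.symm j).1 = (finProdFinEquiv.symm j).2)

/-- The pattern with wild cards on the graph of `f` and zeros elsewhere. -/
def graphPattern {k q : ℕ} (f : Fin k → Fin q) : WildPattern :=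
  List.ofFn fun j : Fin (k * q) =>
    if f (finProdFinEquiv.symm j).1 = (finProdFinEquiv.symm j).2 then none else some false

@[simp]
theorem length_graphWord {k q : ℕ} (X : Finset (Fin k)) (f : Fin k → Fin q) :
    (graphWord X f).length = k * q := by simp [graphWord]

@[simp]
theorem length_graphPattern {k q : ℕ} (f : Fin k → Fin q) :
    (graphPattern f).length = k * q := by simp [graphPattern]

theorem count_none_graphPattern {k q : ℕ} (f : Fin k → Fin q) :
    (graphPattern f).count none = k := by
  have h1 : (graphPattern f).count none = (Finset.univ.filter fun j : Fin (k * q) =>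
      f (finProdFinEquiv.symm j).1 = (finProdFinEquiv.symm j).2).card := by
    rw [graphPattern, List.ofFn_eq_map, List.count, List.countP_map, List.countP_eq_length_filter]
    change _ = (List.filter _ (List.finRange (k * q))).length
    congr 1
    refine List.filter_congr fun j _ => ?_
    by_cases h : f (finProdFinEquiv.symm j).1 = (finProdFinEquiv.symm j).2 <;>
      simp [h, -finProdFinEquiv_symm_apply]
  rw [h1]
  have h2 : (Finset.univ.filter fun j : Fin (k * q) =>
      f (finProdFinEquiv.symm j).1 = (finProdFinEquiv.symm j).2) =
      (Finset.univ : Finset (Fin k)).image fun i => finProdFinEquiv (i, f i) := by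
    ext j
    simp only [Finset.mem_filter, Finset.mem_univ, true_and, Finset.mem_image]
    constructor
    · intro h
      exact ⟨(finProdFinEquiv.symm j).1, by rw [h]; exact finProdFinEquiv.apply_symm_apply j⟩
    · rintro ⟨i, rfl⟩
      simp only [Equiv.symm_apply_apply]
  rw [h2, Finset.card_image_of_injective]
  · simp
  · intro i i' h
    exact congrArg Prod.fst (finProdFinEquiv.injective h)

theorem graphWord_eq_iff {k q : ℕ} {X Y : Finset (Fin k)} {f h : Fin k → Fin q} :
    graphWord X f = graphWord Y h ↔ X = Y ∧ ∀ i ∈ X, f i = h i := by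
  constructor
  · intro heq
    have hj : ∀ (i : Fin k) (b : Fin q), (i ∈ X ∧ f i = b) ↔ (i ∈ Y ∧ h i = b) := by
      intro i b
      have := congrFun (List.ofFn_injective heq) (finProdFinEquiv (i, b))
      simpa only [Equiv.symm_apply_apply, decide_eq_decide] using this
    refine ⟨?_, fun i hi => (((hj i (f i)).1 ⟨hi, rfl⟩).2).symm⟩
    ext i
    exact ⟨fun hi => ((hj i (f i)).1 ⟨hi, rfl⟩).1, fun hi => ((hj i (h i)).2 ⟨hi, rfl⟩).1⟩
  · rintro ⟨rfl, hX⟩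
    unfold graphWord
    congr 1
    funext j
    rw [decide_eq_decide]
    exact and_congr_right fun hi => by rw [hX _ hi]

/-- Equal lengths leave only one alignment, and there the ones of the document must fall on wild
cards. -/
theorem graphPattern_occursIn_iff {k q : ℕ} {X : Finset (Fin k)} {f h : Fin k → Fin q} :
    (graphPattern f).OccursIn (graphWord X h) ↔ ∀ i ∈ X, f i = h i := by
  have hocc : (graphPattern f).OccursIn (graphWord X h) ↔
      List.Forall₂ (fun p c => ∀ b : Bool, p = some b → c = b) (graphPattern f)
        (graphWord X h) := by
    constructor
    · rintro ⟨w, hw, hP⟩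
      have hl := hP.length_eq
      rw [← hw.eq_of_length (by rw [← hl]; simp)]
      exact hP
    · exact fun hP => ⟨_, List.infix_refl _, hP⟩
  rw [hocc, List.forall₂_iff_get]
  constructor
  · rintro ⟨-, hget⟩ i hi
    by_contra hne
    obtain ⟨j, hj⟩ : ∃ j, finProdFinEquiv.symm j = (i, h i) := finProdFinEquiv.symm.surjective _
    have := hget j.1 (by simp) (by simp) false
    simp only [graphPattern, graphWord, List.get_ofFn] at this
    change (if f (finProdFinEquiv.symm j).1 = (finProdFinEquiv.symm j).2 then none
      else some false) = some false → decide ((finProdFinEquiv.symm j).1 ∈ X ∧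
        h (finProdFinEquiv.symm j).1 = (finProdFinEquiv.symm j).2) = false at this
    rw [hj] at this
    simp [hne, hi] at this
  · intro hX
    refine ⟨by simp, fun j h1 h2 b hb => ?_⟩
    simp only [graphPattern, graphWord, List.get_ofFn] at hb ⊢
    split_ifs at hb with hif
    obtain rfl : false = b := Option.some.inj hb
    rw [decide_eq_false_iff_not]
    rintro ⟨hi, hh⟩
    exact hif ((hX _ hi).trans hh)

theorem card_image_graphWord_le {k q : ℕ} (F : Finset (Fin k → Fin q)) (X : Finset (Fin k)) :
    (F.image (graphWord X)).card ≤ q ^ X.card := by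
  classical
  have key : ∀ d ∈ F.image (graphWord X), ∃ f : Fin k → Fin q, graphWord X f = d := fun d hd => by
    obtain ⟨f, -, hf⟩ := Finset.mem_image.1 hd
    exact ⟨f, hf⟩
  choose f hf using key
  have := Finset.card_le_card_of_injOn (s := (F.image (graphWord X)).attach)
    (t := (Finset.univ : Finset (X → Fin q))) (fun d i => f d.1 d.2 i.1) (by simp) (by
      intro d _ d' _ hdd
      apply Subtype.ext
      rw [← hf d.1 d.2, ← hf d'.1 d'.2, graphWord_eq_iff]
      exact ⟨rfl, fun i hi => congrFun hdd ⟨i, hi⟩⟩)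
  simpa using this

/-! ### The hard input -/

/-- Two combinatorial codes give a lower bound for the space of wild card indexing. -/
theorem card_code_le_of_wciSolvable {n k q a r l : ℕ} {Q α s : ℝ} (hs : WCISolvable n k Q α s)
    (A : Finset (Finset (Fin k))) (hA : ∀ X ∈ A, X.card = a)
    (hA' : ∀ X ∈ A, ∀ Y ∈ A, X ≠ Y → r ≤ (X ∪ Y).card)
    (F : Finset (Fin k → Fin q))
    (hF : ∀ f ∈ F, ∀ h ∈ F, ∀ E : Finset (Fin k), r ≤ E.card → (∀ i ∈ E, f i = h i) → f = h)
    (hn : A.card * q ^ a * (k * q) + k * q < n)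
    (hcost : Q + |α| * (((k * q : ℕ) : ℝ) + ((A.card + 1 : ℕ) : ℝ)) <
      (((A.card - 1) * (l + 1) : ℕ) : ℝ)) :
    (F.card : ℝ) ≤ s * 9 ^ l := by
  classical
  -- A single all-zero document `pad` brings the total length to exactly `n`; being longer than `k *
  -- q`, it is not in `D`.
  set D : Finset (List Bool) := A.biUnion fun X => F.image (graphWord X) with hD
  have hDlen : ∀ d ∈ D, d.length = k * q := by
    intro d hd
    obtain ⟨X, -, hd⟩ := Finset.mem_biUnion.1 hd
    obtain ⟨f, -, rfl⟩ := Finset.mem_image.1 hd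
    simp
  have hDcard : D.card ≤ A.card * q ^ a := Finset.card_biUnion_le_card_mul _ _ _ fun X hX => by
    rw [← hA X hX]; exact card_image_graphWord_le F X
  have hDn : D.card * (k * q) + k * q < n :=
    lt_of_le_of_lt (Nat.add_le_add_right (Nat.mul_le_mul_right _ hDcard) _) hn
  set pad : List Bool := List.replicate (n - D.card * (k * q)) false with hpad
  have hpadD : pad ∉ D := fun h => by
    have := hDlen _ h
    rw [hpad, List.length_replicate] at this
    omega
  set docs := insert pad D with hdocs
  have hsum : (∑ d ∈ docs, d.length) = n := by
    rw [hdocs, Finset.sum_insert hpadD, Finset.sum_congr rfl hDlen, hpad, List.length_replicate,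
      Finset.sum_const, smul_eq_mul]
    omega
  obtain ⟨G, hG, hW⟩ := hs docs hsum
  have hmem : ∀ f ∈ F, ∀ X ∈ A, graphWord X f ∈ docs := fun f hf X hX =>
    Finset.mem_insert_of_mem (Finset.mem_biUnion.2 ⟨X, hX, Finset.mem_image_of_mem _ hf⟩)
  let out : (Fin k → Fin q) → Finset {d : List Bool // d ∈ docs} := fun f =>
    (A.image fun X => graphWord X f).subtype (· ∈ docs)
  have hmem_out : ∀ f x, x ∈ out f ↔ ∃ X ∈ A, graphWord X f = x.1 := fun f x => by
    simp [out]
  have hout_card : ∀ f ∈ F, (out f).card = A.card := by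
    intro f hf
    rw [Finset.card_subtype, Finset.filter_true_of_mem, Finset.card_image_of_injective]
    · intro X Y hXY
      exact (graphWord_eq_iff.1 hXY).1
    · intro d hd
      obtain ⟨X, hX, rfl⟩ := Finset.mem_image.1 hd
      exact hmem f hf X hX
  have hcount : F.card ≤ G.size * 9 ^ l := by
    refine G.card_queries_le F out ?_ l ?_
    · intro f hf f' hf' x hx y hy hxy hx' hy'
      obtain ⟨X, hX, hXx⟩ := (hmem_out _ _).1 hx
      obtain ⟨Y, hY, hYy⟩ := (hmem_out _ _).1 hy
      obtain ⟨X', -, hXx'⟩ := (hmem_out _ _).1 hx'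
      obtain ⟨Y', -, hYy'⟩ := (hmem_out _ _).1 hy'
      have hfX := (graphWord_eq_iff.1 (hXx.trans hXx'.symm)).2
      have hfY := (graphWord_eq_iff.1 (hYy.trans hYy'.symm)).2
      have hXY : X ≠ Y := by
        rintro rfl
        exact hxy (Subtype.ext (hXx.symm.trans hYy))
      refine hF f hf f' hf' (X ∪ Y) (hA' X hX Y hY hXY) fun i hi => ?_
      rcases Finset.mem_union.1 hi with hi | hi
      · exact hfX i hi
      · exact hfY i hi
    · intro f hf
      obtain ⟨W, hR, hWc⟩ := hW (graphPattern f) (count_none_graphPattern f)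
      have hsub : out f ⊆ wildOutput docs (graphPattern f) := by
        intro x hx
        obtain ⟨X, hX, hXx⟩ := (hmem_out _ _).1 hx
        rw [wildOutput, Finset.mem_filter]
        refine ⟨Finset.mem_univ _, ?_⟩
        rw [← hXx, graphPattern_occursIn_iff]
        exact fun _ _ => rfl
      -- The extra output is `pad`, which the pattern may match.
      have hle : (wildOutput docs (graphPattern f)).card ≤ A.card + 1 := by
        rw [← hout_card f hf]
        refine (Finset.card_le_card (t := insert ⟨pad, Finset.mem_insert_self _ _⟩ (out f))
          ?_).trans (Finset.card_insert_le _ _)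
        intro x hx
        rw [Finset.mem_insert]
        rcases Finset.mem_insert.1 x.2 with h | h
        · exact Or.inl (Subtype.ext h)
        · right
          obtain ⟨X, hX, h⟩ := Finset.mem_biUnion.1 h
          obtain ⟨h', -, hx'⟩ := Finset.mem_image.1 h
          rw [wildOutput, Finset.mem_filter, ← hx', graphPattern_occursIn_iff] at hx
          refine (hmem_out _ _).2 ⟨X, hX, ?_⟩
          rw [← hx', graphWord_eq_iff]
          exact ⟨rfl, hx.2⟩
      refine ⟨W, ⟨hR.1, fun u hu => hR.2 u (hsub hu)⟩, ?_⟩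
      rw [hout_card f hf]
      have : (W.card : ℝ) < (((A.card - 1) * (l + 1) : ℕ) : ℝ) := by
        refine lt_of_le_of_lt hWc (lt_of_le_of_lt ?_ hcost)
        rw [length_graphPattern]
        have hle' : ((wildOutput docs (graphPattern f)).card : ℝ) ≤ ((A.card + 1 : ℕ) : ℝ) := by
          exact_mod_cast hle
        have h0 : (0 : ℝ) ≤ ((k * q : ℕ) : ℝ) + ((wildOutput docs (graphPattern f)).card : ℝ) := by
          positivity
        have h1 := mul_le_mul_of_nonneg_right (le_abs_self α) h0
        have h2 := mul_le_mul_of_nonneg_left (add_le_add_right hle' ((k * q : ℕ) : ℝ))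
          (abs_nonneg α)
        linarith
      exact_mod_cast this
  calc (F.card : ℝ) ≤ ((G.size * 9 ^ l : ℕ) : ℝ) := by exact_mod_cast hcount
    _ = (G.size : ℝ) * 9 ^ l := by push_cast; rfl
    _ ≤ s * 9 ^ l := mul_le_mul_of_nonneg_right hG (by positivity)

/-! ### Choice of parameters -/

theorem size_lower_bound_of_wciSolvable {n k l : ℕ} {Q α s C : ℝ} (hs : WCISolvable n k Q α s)
    (hk : 200 ≤ k) (hk8 : (k + 1) ^ 8 ≤ 2 ^ k) (hl : 4 * l ≤ k) (hlow : 9 * Nat.log 2 n ≤ k ^ 2)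
    (hup : 10000 * k ≤ Nat.log 2 n) (hC : 0 ≤ C) (hQ : Q ≤ C * 2 ^ ((k : ℝ) / 2))
    (hCl : 2 * (C + 3 * |α|) ≤ l) :
    (n : ℝ) ^ (1 + 1 / 300 : ℝ) ≤ s := by
  set L := Nat.log 2 n with hL
  obtain ⟨A, hA, hA', hAcard⟩ := exists_large_constant_weight_code k
  set a := k / 2 with ha
  set g := k / 64 with hg
  -- With `q = 2 ^ e`, the documents have total length at most `2 ^ (2 * k + e * (a + 1))`; this `e`
  -- keeps that below `n / 4`.
  set e := (L - 2 * k - 2) / (a + 1) with he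
  have hea : e * (a + 1) ≤ L - 2 * k - 2 := Nat.div_mul_le_self _ _
  have hea' : L - 2 * k - 2 < (e + 1) * (a + 1) := by
    rw [mul_comm (e + 1)]
    exact Nat.lt_mul_div_succ _ (Nat.succ_pos a)
  obtain ⟨F, hF, hFcard⟩ := exists_code k (2 ^ e) (a + g) (by omega) (by positivity)
  have hn0 : n ≠ 0 := by
    rintro rfl
    simp at hL
    omega
  have hkpow : k < 2 ^ k := Nat.lt_two_pow_self
  have hA2 : A.card ≤ 2 ^ k := by simpa using Finset.card_le_univ A
  have hLn : 2 ^ L ≤ n := Nat.pow_log_le_self 2 hn0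
  have hlen : A.card * (2 ^ e) ^ a * (k * 2 ^ e) + k * 2 ^ e < n := by
    have h1 : A.card * (2 ^ e) ^ a * (k * 2 ^ e) ≤ 2 ^ (L - 2) := by
      calc A.card * (2 ^ e) ^ a * (k * 2 ^ e) ≤ 2 ^ k * (2 ^ e) ^ a * (2 ^ k * 2 ^ e) := by
            gcongr
        _ = 2 ^ (2 * k + e * (a + 1)) := by rw [← pow_mul, ← pow_add, ← pow_add, ← pow_add]; ring_nf
        _ ≤ 2 ^ (L - 2) := Nat.pow_le_pow_right (by norm_num) (by omega)
    have h2 : k * 2 ^ e ≤ 2 ^ (L - 2) := by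
      calc k * 2 ^ e ≤ 2 ^ k * 2 ^ e := by gcongr
        _ = 2 ^ (k + e) := (pow_add _ _ _).symm
        _ ≤ 2 ^ (L - 2) := by
            refine Nat.pow_le_pow_right (by norm_num) ?_
            have : e ≤ e * (a + 1) := Nat.le_mul_of_pos_right _ (by omega)
            omega
    have h3 : 2 ^ L = 4 * 2 ^ (L - 2) := by
      rw [show L = 2 + (L - 2) by omega, pow_add]; simp
    have h4 : 0 < 2 ^ (L - 2) := by positivity
    omega
  have hA8 : 2 ^ (5 * k) ≤ A.card ^ 8 := by
    have hp : 0 < 2 ^ k := by positivity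
    refine Nat.le_of_mul_le_mul_right ?_ hp
    calc 2 ^ (5 * k) * 2 ^ k = (2 ^ (3 * k)) ^ 2 := by rw [← pow_add, ← pow_mul]; congr 1; ring
      _ ≤ ((A.card * (k + 1)) ^ 4) ^ 2 := Nat.pow_le_pow_left hAcard 2
      _ = A.card ^ 8 * (k + 1) ^ 8 := by rw [← pow_mul, mul_pow]
      _ ≤ A.card ^ 8 * 2 ^ k := Nat.mul_le_mul_left _ hk8
  -- Here `κ ≥ 3 √(log n)` enters: it makes `e` at most `2 * k / 9`, so the pattern length is
  -- absorbed by the output size.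
  have hAq : k * 2 ^ e ≤ A.card := by
    have h9 : 9 * e ≤ 2 * k := by
      have h1 : e * k ≤ 2 * L := by
        have : e * k ≤ e * (2 * (a + 1)) := Nat.mul_le_mul_left _ (by omega)
        have h2 : e * (2 * (a + 1)) = 2 * (e * (a + 1)) := by ring
        omega
      refine Nat.le_of_mul_le_mul_right (c := k) ?_ (by omega)
      calc 9 * e * k = 9 * (e * k) := by ring
        _ ≤ 9 * (2 * L) := Nat.mul_le_mul_left _ h1
        _ = 2 * (9 * L) := by ring
        _ ≤ 2 * k ^ 2 := Nat.mul_le_mul_left _ hlow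
        _ = 2 * k * k := by ring
    refine le_of_pow_le_pow_left₀ (n := 8) (by norm_num) (by positivity) ?_
    calc (k * 2 ^ e) ^ 8 = k ^ 8 * 2 ^ (8 * e) := by rw [mul_pow, ← pow_mul, mul_comm e 8]
      _ ≤ 2 ^ k * 2 ^ (2 * k) := Nat.mul_le_mul
          ((Nat.pow_le_pow_left (Nat.le_succ k) 8).trans hk8)
          (Nat.pow_le_pow_right (by norm_num) (by omega))
      _ = 2 ^ (3 * k) := by rw [← pow_add]; congr 1; ring
      _ ≤ 2 ^ (5 * k) := Nat.pow_le_pow_right (by norm_num) (by omega)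
      _ ≤ A.card ^ 8 := hA8
  have hAsq : 2 ^ k ≤ A.card ^ 2 := by
    refine le_of_pow_le_pow_left₀ (n := 4) (by norm_num) (by positivity) ?_
    calc (2 ^ k) ^ 4 = 2 ^ (4 * k) := by rw [← pow_mul, mul_comm]
      _ ≤ 2 ^ (5 * k) := Nat.pow_le_pow_right (by norm_num) (by omega)
      _ ≤ A.card ^ 8 := hA8
      _ = _ := by rw [← pow_mul]
  have hA200 : 200 ≤ A.card :=
    (hk.trans (Nat.le_mul_of_pos_right k (by positivity))).trans hAq
  have hAQ : (2 : ℝ) ^ ((k : ℝ) / 2) ≤ A.card := by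
    refine le_of_pow_le_pow_left₀ (n := 2) (by norm_num) (by positivity) ?_
    rw [← Real.rpow_natCast, ← Real.rpow_mul (by norm_num)]
    rw [show (k : ℝ) / 2 * ((2 : ℕ) : ℝ) = (k : ℝ) by push_cast; ring, Real.rpow_natCast]
    exact_mod_cast hAsq
  have hcost : Q + |α| * (((k * 2 ^ e : ℕ) : ℝ) + ((A.card + 1 : ℕ) : ℝ)) <
      (((A.card - 1) * (l + 1) : ℕ) : ℝ) := by
    have hα := abs_nonneg α
    have hA1 : (200 : ℝ) ≤ A.card := by exact_mod_cast hA200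
    have h1 : Q ≤ C * A.card := hQ.trans (mul_le_mul_of_nonneg_left hAQ hC)
    have h2 : ((k * 2 ^ e : ℕ) : ℝ) + ((A.card + 1 : ℕ) : ℝ) ≤ 3 * A.card := by
      have : ((k * 2 ^ e : ℕ) : ℝ) ≤ A.card := by exact_mod_cast hAq
      push_cast at this ⊢
      linarith
    have h3 := mul_le_mul_of_nonneg_left h2 hα
    have h4 : (((A.card - 1) * (l + 1) : ℕ) : ℝ) = ((A.card : ℝ) - 1) * (l + 1) := by
      rw [Nat.cast_mul, Nat.cast_sub (by omega)]; push_cast; rfl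
    have h5 : (A.card : ℝ) / 2 * (l + 1) ≤ ((A.card : ℝ) - 1) * (l + 1) :=
      mul_le_mul_of_nonneg_right (by linarith) (by positivity)
    have h6 : (A.card : ℝ) / 2 * (2 * (C + 3 * |α|)) ≤ (A.card : ℝ) / 2 * l :=
      mul_le_mul_of_nonneg_left hCl (by positivity)
    rw [h4]
    linarith
  have hFs := card_code_le_of_wciSolvable hs A hA hA' F hF hlen hcost
  have h9 : (9 : ℝ) ^ l ≤ 2 ^ k := by
    calc (9 : ℝ) ^ l ≤ 16 ^ l := pow_le_pow_left₀ (by norm_num) (by norm_num) l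
      _ = 2 ^ (4 * l) := by rw [pow_mul]; norm_num
      _ ≤ 2 ^ k := pow_le_pow_right₀ (by norm_num) hl
  have hs0 : 0 ≤ s := by
    have h0 : (0 : ℝ) ≤ s * 9 ^ l := (Nat.cast_nonneg _).trans hFs
    exact nonneg_of_mul_nonneg_left h0 (by positivity)
  have hmain : (2 : ℝ) ^ (e * (a + g)) ≤ s * 2 ^ (2 * k) := by
    calc (2 : ℝ) ^ (e * (a + g)) ≤ F.card * 2 ^ k := by
          rw [pow_mul]; exact_mod_cast hFcard
      _ ≤ s * 9 ^ l * 2 ^ k := mul_le_mul_of_nonneg_right hFs (by positivity)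
      _ ≤ s * 2 ^ k * 2 ^ k := by gcongr
      _ = s * 2 ^ (2 * k) := by rw [two_mul, pow_add]; ring
  -- For `k ≥ 200`, `a + 1 ≤ 128 * (g - 1)`, so `a + g ≥ (129 / 128) * (a + 1)`. The gap between `1
  -- / 128` and `1 / 300` absorbs the `O(k)` losses.
  have hexp : 129 * L ≤ 128 * (e * (a + g)) + 516 * k := by
    have h1 : L ≤ e * (a + 1) + 4 * k := by
      have : (e + 1) * (a + 1) = e * (a + 1) + (a + 1) := by ring
      omega
    have h2 : e * (a + 1) ≤ e * (128 * (g - 1)) := Nat.mul_le_mul_left _ (by omega)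
    have h3 : 128 * (e * (a + g)) = 128 * (e * (a + 1)) + e * (128 * (g - 1)) := by
      obtain ⟨g', hg'⟩ : ∃ g', g = g' + 1 := ⟨g - 1, by omega⟩
      rw [hg']
      simp only [Nat.add_sub_cancel]
      ring
    omega
  have hn2 : (n : ℝ) ≤ 2 ^ ((L : ℝ) + 1) := by
    have : n ≤ 2 ^ (L + 1) := (Nat.lt_pow_succ_log_self (by norm_num) n).le
    rw [show (L : ℝ) + 1 = ((L + 1 : ℕ) : ℝ) by push_cast; rfl, Real.rpow_natCast]
    exact_mod_cast this
  have hpos : (0 : ℝ) < 2 ^ (2 * k) := by positivity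
  refine le_of_mul_le_mul_right (le_trans ?_ hmain) hpos
  calc (n : ℝ) ^ (1 + 1 / 300 : ℝ) * 2 ^ (2 * k)
      ≤ ((2 : ℝ) ^ ((L : ℝ) + 1)) ^ (1 + 1 / 300 : ℝ) * 2 ^ (2 * k) := by
        gcongr
    _ = (2 : ℝ) ^ (((L : ℝ) + 1) * (1 + 1 / 300) + ((2 * k : ℕ) : ℝ)) := by
        rw [← Real.rpow_mul (by norm_num), ← Real.rpow_natCast, ← Real.rpow_add (by norm_num)]
    _ ≤ (2 : ℝ) ^ ((e * (a + g) : ℕ) : ℝ) := by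
        refine Real.rpow_le_rpow_of_exponent_le (by norm_num) ?_
        have h1 : (129 : ℝ) * L ≤ 128 * ((e * (a + g) : ℕ) : ℝ) + 516 * k := by
          exact_mod_cast hexp
        have h2 : (10000 : ℝ) * k ≤ L := by exact_mod_cast hup
        have h3 : (200 : ℝ) ≤ k := by exact_mod_cast hk
        rw [Nat.cast_mul 2 k, Nat.cast_ofNat]
        linarith
    _ = (2 : ℝ) ^ (e * (a + g)) := Real.rpow_natCast _ _

/-! ### Asymptotics -/

theorem eventually_add_one_pow_le_two_pow (d : ℕ) : ∀ᶠ k : ℕ in atTop, (k + 1) ^ d ≤ 2 ^ k := by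
  have h := (tendsto_pow_const_div_const_pow_of_one_lt d (r := (2 : ℝ)) (by norm_num)).comp
    (tendsto_add_atTop_nat 1)
  filter_upwards [h.eventually (gt_mem_nhds (show (0 : ℝ) < 1 / 2 by norm_num))] with k hk
  simp only [Function.comp_apply] at hk
  rw [div_lt_iff₀ (by positivity), pow_succ] at hk
  have : ((k + 1 : ℕ) : ℝ) ^ d ≤ 2 ^ k := by linarith
  exact_mod_cast this

theorem mainTheorem4 :
    ∃ c : ℝ, 0 < c ∧
      ∀ (κ : ℕ → ℕ) (Q S : ℕ → ℕ → ℝ) (α : ℝ),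
        (∀ᶠ n : ℕ in atTop, 3 * Real.sqrt (Real.logb 2 (n : ℝ)) ≤ (κ n : ℝ)) →
        ((fun n : ℕ => (κ n : ℝ)) =o[atTop] fun n : ℕ => Real.logb 2 (n : ℝ)) →
        ((fun n : ℕ => Q n (κ n)) =O[atTop] fun n : ℕ => (2 : ℝ) ^ ((κ n : ℝ) / 2)) →
        (∀ᶠ n : ℕ in atTop, WCISolvable n (κ n) (Q n (κ n)) α (S n (κ n))) →
        ∀ᶠ n : ℕ in atTop,
          (n : ℝ) ^ (1 + c / Real.logb 2 (κ n : ℝ)) ≤ S n (κ n) := by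
  refine ⟨1 / 300, by norm_num, ?_⟩
  intro κ Q S α hlow hup hQ hsolv
  obtain ⟨C, hC, hQC⟩ := hQ.exists_nonneg
  have hlogb : Tendsto (fun n : ℕ => Real.logb 2 (n : ℝ)) atTop atTop :=
    (Real.tendsto_logb_atTop (by norm_num)).comp tendsto_natCast_atTop_atTop
  have hκ : Tendsto κ atTop atTop := by
    rw [← tendsto_natCast_atTop_iff (R := ℝ)]
    exact tendsto_atTop_mono' atTop hlow
      ((Real.tendsto_sqrt_atTop.comp hlogb).const_mul_atTop (by norm_num))
  -- The path length `l` is independent of `n`. The cost is at most `C + 3 * |α|` per element of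
  -- `A`, and the 2 covers `|A| - 1 ≥ |A| / 2`.
  obtain ⟨l, hl⟩ := exists_nat_ge (2 * (C + 3 * |α|))
  filter_upwards [hlow, hup.bound (show (0 : ℝ) < 1 / 20000 by norm_num), hQC.bound, hsolv,
    hκ.eventually_ge_atTop 200, hκ.eventually_ge_atTop (4 * l),
    hκ.eventually (eventually_add_one_pow_le_two_pow 8), eventually_ge_atTop 2]
    with n h1 h2 h3 h4 h5 h6 h7 h8
  have hn1 : (1 : ℝ) < n := by exact_mod_cast h8
  have hL1 : (Nat.log 2 n : ℝ) ≤ Real.logb 2 n := Real.natLog_le_logb n 2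
  have hL2 : Real.logb 2 n ≤ (Nat.log 2 n : ℝ) + 1 := by
    rw [Real.logb_le_iff_le_rpow (by norm_num) (by linarith)]
    have : n ≤ 2 ^ (Nat.log 2 n + 1) := (Nat.lt_pow_succ_log_self (by norm_num) n).le
    rw [show (Nat.log 2 n : ℝ) + 1 = ((Nat.log 2 n + 1 : ℕ) : ℝ) by push_cast; rfl,
      Real.rpow_natCast]
    exact_mod_cast this
  have hk200 : (200 : ℝ) ≤ κ n := by exact_mod_cast h5
  have hlog0 : 0 ≤ Real.logb 2 n := (Nat.cast_nonneg _).trans hL1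
  have hlow' : 9 * Nat.log 2 n ≤ κ n ^ 2 := by
    have h : 9 * Real.logb 2 n ≤ (κ n : ℝ) ^ 2 := by
      have := pow_le_pow_left₀ (by positivity) h1 2
      rwa [mul_pow, Real.sq_sqrt hlog0, show (3 : ℝ) ^ 2 = 9 by norm_num] at this
    have : (9 : ℝ) * Nat.log 2 n ≤ (κ n : ℝ) ^ 2 := by linarith
    exact_mod_cast this
  have hup' : 10000 * κ n ≤ Nat.log 2 n := by
    rw [Real.norm_of_nonneg (Nat.cast_nonneg _), Real.norm_of_nonneg hlog0] at h2
    have : (10000 : ℝ) * κ n ≤ Nat.log 2 n := by linarith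
    exact_mod_cast this
  have hQ' : Q n (κ n) ≤ C * 2 ^ ((κ n : ℝ) / 2) := by
    rw [Real.norm_of_nonneg (by positivity : (0 : ℝ) ≤ 2 ^ ((κ n : ℝ) / 2))] at h3
    exact (le_abs_self _).trans h3
  refine le_trans ?_ (size_lower_bound_of_wciSolvable h4 h5 h7 h6 hlow' hup' hC hQ' hl)
  refine Real.rpow_le_rpow_of_exponent_le hn1.le ?_
  have hlogκ : 1 ≤ Real.logb 2 (κ n : ℝ) := by
    rw [Real.le_logb_iff_rpow_le (by norm_num) (by linarith), Real.rpow_one]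
    linarith
  have : (1 / 300 : ℝ) / Real.logb 2 (κ n : ℝ) ≤ 1 / 300 :=
    div_le_self (by norm_num) hlogκ
  linarith
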